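/- Let $\ell>0$, $0<a\le b<\infty$, $0<t<1$ and $k\in\mathbb N$, $k\ge 1$. Let $\{m_\varepsilon\}$, $\{n_\varepsilon\}$ be families of weights in $L^\infty([0,\ell])$ with $a\le m_\varepsilon, n_\varepsilon\le b$ a.e. in $(0,\ell)$ for every $\varepsilon$. For $(\alpha,\beta)\in\mathbb R^2$, an eigenfunction of $$(P_\varepsilon)\qquad -u''=\alpha\, m_\varepsilon u^+-\beta\, n_\varepsilon u^-\ \text{ in }(0,\ell),\qquad u(0)=u(\ell)=0,\qquad u^\pm=\max\{0,\pm u\},$$ associated to $(\alpha,\beta)$ is a function $u\in H^1_0([0,\ell])$, $u\not\equiv 0$ (always identified with its continuous representative), such that $\int_0^\ell u'v'\,dx=\int_0^\ell(\alpha m_\varepsilon u^+-\beta n_\varepsilon u^-)v\,dx$ for all $v\in H^1_0([0,\ell])$. The nodal domains of $u$ are the connected components of $\{x\in(0,\ell):u(x)\ne 0\}$. Let $\mathcal C_{k,\varepsilon}=\mathcal C_{k,\varepsilon}^+\cup\mathcal C_{k,\varepsilon}^-$, where $\mathcal C_{k,\varepsilon}^+$ (resp. $\mathcal C_{k,\varepsilon}^-$)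 is the set of $(\alpha,\beta)\in\mathbb R^2$ that have an eigenfunction with exactly $k$ nodal domains and with positive (resp. negative) slope at the origin, and let $$\mathcal K_t=\{(\alpha,\beta)\in(0,\infty)\times(0,\infty): t\alpha\le\beta\le t^{-1}\alpha\}.$$ **Theorem.** Let $(\alpha,\beta)\in\mathcal C_{k,\varepsilon}\cap\mathcal K_t$ and let $u$ be any eigenfunction of $(P_\varepsilon)$ associated to $(\alpha,\beta)$. Then every nodal domain $I$ of $u$ satisfies $$|I|\ge\frac{\ell}{k}\sqrt{t\,\frac ab}.$$ Moreover, if $J$ is the union of two consecutive nodal domains of $u$ (that is, of two distinct nodal domains with no other nodal domain between them), then $$|J|\ge\frac{\ell}{k}\sqrt{\frac ab}\,\bigl(1+\sqrt t\bigr).$$ -/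

import Mathlib

open MeasureTheory Set

/-- `r` is an `L^∞` weight on `(0, ℓ)` with `a ≤ r ≤ b` almost everywhere. -/
structure IsWeight (ℓ a b : ℝ) (r : ℝ → ℝ) : Prop where
  memLp : MemLp r ⊤ (volume.restrict (Ioo 0 ℓ))
  bounds : ∀ᵐ x ∂(volume.restrict (Ioo 0 ℓ)), a ≤ r x ∧ r x ≤ b

/-- `u ∈ H^1_0([0, ℓ])`, through the continuous representative: `u` is absolutely continuous on
`[0, ℓ]`, its (almost everywhere defined) derivative is in `L^2(0, ℓ)`, and `u` vanishes at the two
endpoints. The values of `u` outside `[0, ℓ]` play no role. -/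
structure MemH10 (ℓ : ℝ) (u : ℝ → ℝ) : Prop where
  absCont : AbsolutelyContinuousOnInterval u 0 ℓ
  memLp_deriv : MemLp (deriv u) 2 (volume.restrict (Ioo 0 ℓ))
  left : u 0 = 0
  right : u ℓ = 0

/-- `u` is a nontrivial weak solution (an eigenfunction associated to `(α, β)`) of
`-u'' = α m u⁺ - β n u⁻` in `(0, ℓ)`, `u(0) = u(ℓ) = 0`, where `u^± = max {0, ± u}`. -/
structure IsFucikEigenfunction (ℓ : ℝ) (m n : ℝ → ℝ) (α β : ℝ) (u : ℝ → ℝ) : Prop where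
  memH10 : MemH10 ℓ u
  weak : ∀ v : ℝ → ℝ, MemH10 ℓ v →
    ∫ x in (0 : ℝ)..ℓ, deriv u x * deriv v x =
      ∫ x in (0 : ℝ)..ℓ, (α * m x * max 0 (u x) - β * n x * max 0 (-u x)) * v x
  nontrivial : ∃ x ∈ Icc 0 ℓ, u x ≠ 0

/-- The nodal domains of `u` are the connected components of `{x ∈ (0, ℓ) : u x ≠ 0}`. -/
def IsNodalDomain (ℓ : ℝ) (u : ℝ → ℝ) (I : Set ℝ) : Prop :=
  ∃ x ∈ {y ∈ Ioo 0 ℓ | u y ≠ 0}, I = connectedComponentIn {y ∈ Ioo 0 ℓ | u y ≠ 0} x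

/-- `I` and `I'` are consecutive nodal domains of `u`: `I` lies to the left of `I'`, and no nodal
domain of `u` lies between them. -/
structure AreConsecutiveNodalDomains (ℓ : ℝ) (u : ℝ → ℝ) (I I' : Set ℝ) : Prop where
  fst : IsNodalDomain ℓ u I
  snd : IsNodalDomain ℓ u I'
  lt : ∀ x ∈ I, ∀ y ∈ I', x < y
  none_between : ∀ K : Set ℝ, IsNodalDomain ℓ u K →
    ¬ ((∀ x ∈ I, ∀ z ∈ K, x < z) ∧ (∀ z ∈ K, ∀ y ∈ I', z < y))

/-- The curve `C_k^+` of the spectrum: the points `(α, β)` that have an eigenfunction with exactly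
`k` nodal domains and positive slope at the origin. -/
def fucikCurvePos (ℓ : ℝ) (m n : ℝ → ℝ) (k : ℕ) : Set (ℝ × ℝ) :=
  {p | ∃ u : ℝ → ℝ, IsFucikEigenfunction ℓ m n p.1 p.2 u ∧
    {I : Set ℝ | IsNodalDomain ℓ u I}.encard = k ∧
    ∃ s : ℝ, 0 < s ∧ HasDerivWithinAt u s (Ici 0) 0}

/-- The curve `C_k^-` of the spectrum: the points `(α, β)` that have an eigenfunction with exactly
`k` nodal domains and negative slope at the origin. -/
def fucikCurveNeg (ℓ : ℝ) (m n : ℝ → ℝ) (k : ℕ) : Set (ℝ × ℝ) :=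
  {p | ∃ u : ℝ → ℝ, IsFucikEigenfunction ℓ m n p.1 p.2 u ∧
    {I : Set ℝ | IsNodalDomain ℓ u I}.encard = k ∧
    ∃ s : ℝ, s < 0 ∧ HasDerivWithinAt u s (Ici 0) 0}

/-- `C_k = C_k^+ ∪ C_k^-`. -/
def fucikCurve (ℓ : ℝ) (m n : ℝ → ℝ) (k : ℕ) : Set (ℝ × ℝ) :=
  fucikCurvePos ℓ m n k ∪ fucikCurveNeg ℓ m n k

/-- The symmetric cone `K_t` in the open first quadrant. -/
def fucikCone (t : ℝ) : Set (ℝ × ℝ) :=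
  {p | 0 < p.1 ∧ 0 < p.2 ∧ t * p.1 ≤ p.2 ∧ p.2 ≤ t⁻¹ * p.1}

/-! On a nodal domain of length `L` the equation is linear with a single weight, and `π / L` is the
frequency of the first Dirichlet sine. Testing with that sine gives `γ a ≤ (π / L)² ≤ γ b`, where
`γ` is `α` or `β` according to the sign of `u` (`weight_bounds_of_pos`, `weight_bounds_of_neg`). So
`π / √(γ b) ≤ L ≤ π / √(γ a)`.

The upper bounds are applied to an eigenfunction `w` with exactly `k` nodal domains, which need not
be `u`. The closures of its domains cover `(0, ℓ)`, so `ℓ ≤ k π / √(a min(α, β))`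
(`length_le_of_encard`). The lower bounds are applied to `u`, and the cone condition compares `α`
and `β` with their minimum, at the cost of a factor `√t`. Consecutive domains carry opposite signs,
so one of the two needs no such factor.

Both the covering and the sign change rest on a strong maximum principle: where `u ≥ 0` it is
concave, and a concave nonnegative function with an interior zero vanishes. -/

/-! ### Test functions supported in a subinterval, and weighted integrals -/

theorem LipschitzWith.memH10 {ℓ : ℝ} {K : NNReal} {v : ℝ → ℝ} (hv : LipschitzWith K v)
    (h0 : v 0 = 0) (h1 : v ℓ = 0) : MemH10 ℓ v where
  absCont := (hv.lipschitzOnWith (s := uIcc 0 ℓ)).absolutelyContinuousOnInterval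
  memLp_deriv := by
    have : MemLp (deriv v) ⊤ (volume.restrict (Ioo 0 ℓ)) :=
      memLp_top_of_bound (measurable_deriv v).aestronglyMeasurable K
        (Filter.Eventually.of_forall fun x => norm_deriv_le_of_lipschitz hv)
    exact this.mono_exponent le_top
  left := h0
  right := h1

theorem integral_eq_integral_of_eq_zero_outside {f : ℝ → ℝ} {a b p r : ℝ} (hp : a ≤ p)
    (hpr : p ≤ r) (hr : r ≤ b) (hf : ∀ x, x < p ∨ r < x → f x = 0) :
    ∫ x in a..b, f x = ∫ x in p..r, f x := by
  rw [intervalIntegral.integral_of_le (by linarith), intervalIntegral.integral_of_le hpr,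
    ← integral_Icc_eq_integral_Ioc, ← integral_Icc_eq_integral_Ioc]
  refine setIntegral_eq_of_subset_of_forall_sdiff_eq_zero measurableSet_Icc
    (Icc_subset_Icc hp hr) fun x hx => hf x ?_
  by_contra! h
  exact hx.2 h

theorem deriv_eq_zero_of_eq_zero_outside {v : ℝ → ℝ} {p r : ℝ}
    (hv : ∀ x, x ≤ p ∨ r ≤ x → v x = 0) {x : ℝ} (hx : x < p ∨ r < x) : deriv v x = 0 := by
  have h : v =ᶠ[nhds x] fun _ => (0 : ℝ) := by
    rcases hx with hx | hx
    · filter_upwards [Iio_mem_nhds hx] with y hy using hv y (Or.inl hy.le)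
    · filter_upwards [Ioi_mem_nhds hx] with y hy using hv y (Or.inr hy.le)
  rw [h.deriv_eq, deriv_const]

theorem integral_congr_of_eqOn_Ioo {f g : ℝ → ℝ} {p r : ℝ} (hpr : p ≤ r)
    (h : ∀ x ∈ Ioo p r, f x = g x) : ∫ x in p..r, f x = ∫ x in p..r, g x := by
  rw [intervalIntegral.integral_of_le hpr, intervalIntegral.integral_of_le hpr,
    integral_Ioc_eq_integral_Ioo, integral_Ioc_eq_integral_Ioo]
  exact setIntegral_congr_fun measurableSet_Ioo h

namespace IsWeight

variable {ℓ a b : ℝ} {m : ℝ → ℝ}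

theorem intervalIntegrable_mul (hm : IsWeight ℓ a b m) {p r : ℝ} (hp : 0 ≤ p) (hpr : p ≤ r)
    (hr : r ≤ ℓ) {g : ℝ → ℝ} (hg : ContinuousOn g (Icc p r)) :
    IntervalIntegrable (fun x => m x * g x) volume p r := by
  rw [intervalIntegrable_iff_integrableOn_Ioo_of_le hpr]
  have h1 : IntegrableOn g (Ioo p r) := hg.integrableOn_Icc.mono_set Ioo_subset_Icc_self
  have h2 : MemLp m ⊤ (volume.restrict (Ioo p r)) :=
    hm.memLp.mono_measure (Measure.restrict_mono (Ioo_subset_Ioo hp hr) le_rfl)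
  exact h1.mul_of_top_right h2

theorem integral_mul_bounds (hm : IsWeight ℓ a b m) {p r : ℝ} (hp : 0 ≤ p) (hpr : p ≤ r)
    (hr : r ≤ ℓ) {g : ℝ → ℝ} (hg : ContinuousOn g (Icc p r)) (hg0 : ∀ x ∈ Icc p r, 0 ≤ g x) :
    a * ∫ x in p..r, g x ≤ ∫ x in p..r, m x * g x ∧
      ∫ x in p..r, m x * g x ≤ b * ∫ x in p..r, g x := by
  have hi := hm.intervalIntegrable_mul hp hpr hr hg
  have hgi : IntervalIntegrable g volume p r := hg.intervalIntegrable_of_Icc hpr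
  have hae : ∀ᵐ x ∂(volume.restrict (Icc p r)), a ≤ m x ∧ m x ≤ b := by
    rw [restrict_Ioo_eq_restrict_Icc.symm]
    exact ae_restrict_of_ae_restrict_of_subset (Ioo_subset_Ioo hp hr) hm.bounds
  have hmem : ∀ᵐ x ∂(volume.restrict (Icc p r)), x ∈ Icc p r := ae_restrict_mem measurableSet_Icc
  rw [← intervalIntegral.integral_const_mul, ← intervalIntegral.integral_const_mul]
  constructor
  · refine intervalIntegral.integral_mono_ae_restrict hpr (hgi.const_mul a) hi ?_
    filter_upwards [hae, hmem] with x hx hx'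
    exact mul_le_mul_of_nonneg_right hx.1 (hg0 x hx')
  · refine intervalIntegral.integral_mono_ae_restrict hpr hi (hgi.const_mul b) ?_
    filter_upwards [hae, hmem] with x hx hx'
    exact mul_le_mul_of_nonneg_right hx.2 (hg0 x hx')

end IsWeight

/-! ### Intervals of constant sign: concavity and eigenvalue comparison -/

namespace IsFucikEigenfunction

variable {ℓ a b α β : ℝ} {m n u : ℝ → ℝ}

/-- This symmetry reduces every statement about negative pieces to the positive case. -/
theorem neg (hu : IsFucikEigenfunction ℓ m n α β u) :
    IsFucikEigenfunction ℓ n m β α (fun x => -u x) where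
  memH10 :=
    { absCont := hu.memH10.absCont.neg
      memLp_deriv := by
        have h : deriv (fun x => -u x) = -deriv u := by
          funext x
          simp
        rw [h]
        exact hu.memH10.memLp_deriv.neg
      left := by simp [hu.memH10.left]
      right := by simp [hu.memH10.right] }
  weak v hv := by
    have h := congrArg Neg.neg (hu.weak v hv)
    rw [← intervalIntegral.integral_neg, ← intervalIntegral.integral_neg] at h
    convert h using 3 with x x
    · simp
    · simp only [neg_neg]
      ring
  nontrivial := by
    obtain ⟨x, hx, h⟩ := hu.nontrivial
    exact ⟨x, hx, neg_ne_zero.mpr h⟩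

theorem absCont_mono (hu : IsFucikEigenfunction ℓ m n α β u) {p r : ℝ} (hp : 0 ≤ p)
    (hpr : p ≤ r) (hr : r ≤ ℓ) : AbsolutelyContinuousOnInterval u p r := by
  refine hu.memH10.absCont.mono ?_
  rw [uIcc_of_le hpr, uIcc_of_le (by linarith)]
  exact Icc_subset_Icc hp hr

theorem continuousOn (hu : IsFucikEigenfunction ℓ m n α β u) (hℓ : 0 ≤ ℓ) :
    ContinuousOn u (Icc 0 ℓ) := by
  simpa [uIcc_of_le hℓ] using hu.memH10.absCont.continuousOn

theorem weak_of_nonneg (hu : IsFucikEigenfunction ℓ m n α β u) {p r : ℝ} (hp : 0 ≤ p)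
    (hpr : p ≤ r) (hr : r ≤ ℓ) (hpos : ∀ x ∈ Icc p r, 0 ≤ u x) {K : NNReal} {v : ℝ → ℝ}
    (hv : LipschitzWith K v) (hv0 : ∀ x, x ≤ p ∨ r ≤ x → v x = 0) :
    ∫ x in p..r, deriv u x * deriv v x = α * ∫ x in p..r, m x * (u x * v x) := by
  have h := hu.weak v (hv.memH10 (hv0 0 (Or.inl hp)) (hv0 ℓ (Or.inr hr)))
  rw [integral_eq_integral_of_eq_zero_outside hp hpr hr (fun x hx => by
      rw [deriv_eq_zero_of_eq_zero_outside hv0 hx, mul_zero]),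
    integral_eq_integral_of_eq_zero_outside hp hpr hr (fun x hx => by
      rw [hv0 x (hx.imp le_of_lt le_of_lt), mul_zero])] at h
  rw [h, ← intervalIntegral.integral_const_mul]
  refine integral_congr_of_eqOn_Ioo hpr fun x hx => ?_
  have hx0 := hpos x (Ioo_subset_Icc_self hx)
  rw [max_eq_right hx0, max_eq_left (by linarith)]
  ring

/-- The tent function on `[p, r]` with peak `1` at `q`. -/
noncomputable def tent (p q r x : ℝ) : ℝ := max 0 (min ((q - p)⁻¹ * (x - p)) ((r - q)⁻¹ * (r - x)))

theorem lipschitzWith_tent (p q r : ℝ) : ∃ K, LipschitzWith K (tent p q r) := by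
  have h1 : LipschitzWith ‖(q - p)⁻¹‖₊ fun x : ℝ => (q - p)⁻¹ * (x - p) :=
    LipschitzWith.of_dist_le_mul fun x y => by
      simp only [Real.dist_eq, coe_nnnorm, Real.norm_eq_abs, ← abs_mul]
      apply le_of_eq; congr 1; ring
  have h2 : LipschitzWith ‖(r - q)⁻¹‖₊ fun x : ℝ => (r - q)⁻¹ * (r - x) :=
    LipschitzWith.of_dist_le_mul fun x y => by
      simp only [Real.dist_eq, coe_nnnorm, Real.norm_eq_abs, ← abs_mul]
      rw [← abs_neg]
      apply le_of_eq; congr 1; ring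
  exact ⟨_, (h1.min h2).const_max 0⟩

theorem tent_of_mem_left {p q r x : ℝ} (hqr : q < r) (hx : x ∈ Ioo p q) :
    tent p q r x = (q - p)⁻¹ * (x - p) := by
  obtain ⟨h1, h2⟩ := hx
  have hqp : 0 < q - p := by linarith
  have hrq : 0 < r - q := by linarith
  have e1 : (q - p)⁻¹ * (x - p) ≤ 1 := by
    rw [inv_mul_le_iff₀ hqp]; linarith
  have e2 : 1 ≤ (r - q)⁻¹ * (r - x) := by
    rw [le_inv_mul_iff₀ hrq]; linarith
  have e3 : 0 ≤ (q - p)⁻¹ * (x - p) := mul_nonneg (by positivity) (by linarith)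
  rw [tent, min_eq_left (e1.trans e2), max_eq_right e3]

theorem tent_of_mem_right {p q r x : ℝ} (hpq : p < q) (hx : x ∈ Ioo q r) :
    tent p q r x = (r - q)⁻¹ * (r - x) := by
  obtain ⟨h1, h2⟩ := hx
  have hqp : 0 < q - p := by linarith
  have hrq : 0 < r - q := by linarith
  have e1 : (r - q)⁻¹ * (r - x) ≤ 1 := by
    rw [inv_mul_le_iff₀ hrq]; linarith
  have e2 : 1 ≤ (q - p)⁻¹ * (x - p) := by
    rw [le_inv_mul_iff₀ hqp]; linarith
  have e3 : 0 ≤ (r - q)⁻¹ * (r - x) := mul_nonneg (by positivity) (by linarith)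
  rw [tent, min_eq_right (e1.trans e2), max_eq_right e3]

theorem tent_eq_zero {p q r x : ℝ} (hpq : p < q) (hqr : q < r) (hx : x ≤ p ∨ r ≤ x) :
    tent p q r x = 0 := by
  have hqp : 0 < q - p := by linarith
  have hrq : 0 < r - q := by linarith
  refine max_eq_left ?_
  rcases hx with hx | hx
  · exact (min_le_left _ _).trans
      (mul_nonpos_of_nonneg_of_nonpos (by positivity) (by linarith))
  · exact (min_le_right _ _).trans
      (mul_nonpos_of_nonneg_of_nonpos (by positivity) (by linarith))

/-- A nonnegative piece of an eigenfunction is concave. -/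
theorem slope_le_slope (hu : IsFucikEigenfunction ℓ m n α β u) (ha : 0 ≤ a)
    (hm : IsWeight ℓ a b m) (hα : 0 ≤ α) {p q r : ℝ} (hp : 0 ≤ p) (hpq : p < q) (hqr : q < r)
    (hr : r ≤ ℓ) (hpos : ∀ x ∈ Icc p r, 0 ≤ u x) :
    (r - q)⁻¹ * (u r - u q) ≤ (q - p)⁻¹ * (u q - u p) := by
  obtain ⟨K, hK⟩ := lipschitzWith_tent p q r
  have hpr : p ≤ r := by linarith
  -- Tested with the tent, the left side of the equation is the slope on `[p, q]` minus the slope on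
  -- `[q, r]`; the right side is nonnegative.
  have hw := hu.weak_of_nonneg hp hpr hr hpos hK fun x hx => tent_eq_zero hpq hqr hx
  have huc : ContinuousOn u (Icc p r) :=
    (hu.continuousOn (by linarith)).mono (Icc_subset_Icc hp hr)
  have hg0 : ∀ x ∈ Icc p r, 0 ≤ u x * tent p q r x := fun x hx =>
    mul_nonneg (hpos x hx) (le_max_left _ _)
  have hrhs := (hm.integral_mul_bounds hp hpr hr (huc.mul hK.continuous.continuousOn) hg0).1
  have hint : 0 ≤ ∫ x in p..r, u x * tent p q r x := intervalIntegral.integral_nonneg hpr hg0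
  have hnn : 0 ≤ ∫ x in p..r, deriv u x * deriv (tent p q r) x := by
    rw [hw]
    exact mul_nonneg hα (le_trans (mul_nonneg ha hint) hrhs)
  have hu1 := hu.absCont_mono hp hpq.le (by linarith)
  have hu2 := hu.absCont_mono (by linarith) hqr.le hr
  have e1 : ∀ x ∈ Ioo p q, deriv u x * deriv (tent p q r) x = (q - p)⁻¹ * deriv u x := by
    intro x hx
    have h : tent p q r =ᶠ[nhds x] fun x => (q - p)⁻¹ * (x - p) := by
      filter_upwards [Ioo_mem_nhds hx.1 hx.2] with y hy using tent_of_mem_left hqr hy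
    rw [h.deriv_eq, ((hasDerivAt_id' x |>.sub_const p).const_mul _).deriv]
    ring
  have e2 : ∀ x ∈ Ioo q r, deriv u x * deriv (tent p q r) x = -(r - q)⁻¹ * deriv u x := by
    intro x hx
    have h : tent p q r =ᶠ[nhds x] fun x => (r - q)⁻¹ * (r - x) := by
      filter_upwards [Ioo_mem_nhds hx.1 hx.2] with y hy using tent_of_mem_right hpq hy
    rw [h.deriv_eq, ((hasDerivAt_id' x |>.const_sub r).const_mul _).deriv]
    ring
  have i1 : IntervalIntegrable (fun x => deriv u x * deriv (tent p q r) x) volume p q := by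
    rw [intervalIntegrable_iff_integrableOn_Ioo_of_le hpq.le, integrableOn_congr_fun e1
      measurableSet_Ioo, ← intervalIntegrable_iff_integrableOn_Ioo_of_le hpq.le]
    exact hu1.intervalIntegrable_deriv.const_mul _
  have i2 : IntervalIntegrable (fun x => deriv u x * deriv (tent p q r) x) volume q r := by
    rw [intervalIntegrable_iff_integrableOn_Ioo_of_le hqr.le, integrableOn_congr_fun e2
      measurableSet_Ioo, ← intervalIntegrable_iff_integrableOn_Ioo_of_le hqr.le]
    exact hu2.intervalIntegrable_deriv.const_mul _
  rw [← intervalIntegral.integral_add_adjacent_intervals i1 i2,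
    integral_congr_of_eqOn_Ioo hpq.le e1, integral_congr_of_eqOn_Ioo hqr.le e2,
    intervalIntegral.integral_const_mul, intervalIntegral.integral_const_mul,
    hu1.integral_deriv_eq_sub, hu2.integral_deriv_eq_sub] at hnn
  linarith

/-- Strong maximum principle for a nonnegative piece of an eigenfunction. -/
theorem eq_zero_of_nonneg_of_eq_zero (hu : IsFucikEigenfunction ℓ m n α β u) (ha : 0 ≤ a)
    (hm : IsWeight ℓ a b m) (hα : 0 ≤ α) {p q r : ℝ} (hp : 0 ≤ p) (hpq : p < q) (hqr : q < r)
    (hr : r ≤ ℓ) (hpos : ∀ x ∈ Icc p r, 0 ≤ u x) (hq : u q = 0) : u p = 0 ∧ u r = 0 := by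
  have h := hu.slope_le_slope ha hm hα hp hpq hqr hr hpos
  have h1 := hpos p ⟨le_rfl, by linarith⟩
  have h2 := hpos r ⟨by linarith, le_rfl⟩
  have hqp : 0 < (q - p)⁻¹ := inv_pos.mpr (by linarith)
  have hrq : 0 < (r - q)⁻¹ := inv_pos.mpr (by linarith)
  -- Now the slope after `q` is nonnegative, the slope before it is nonpositive, and concavity
  -- forces both to be zero.
  rw [hq] at h
  constructor <;> nlinarith [mul_nonneg hqp.le h1, mul_nonneg hrq.le h2]

/-- With `v` the first Dirichlet sine of `(c, d)`, the weak equation and an integration by parts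
give `κ² ∫ u v = α ∫ m u v`. Since `u v > 0` inside, the bounds on `m` pass to `κ²`. -/
theorem weight_bounds_of_pos (hu : IsFucikEigenfunction ℓ m n α β u)
    (hm : IsWeight ℓ a b m) (hα : 0 ≤ α) {c d : ℝ} (hc : 0 ≤ c) (hcd : c < d) (hd : d ≤ ℓ)
    (huc : u c = 0) (hud : u d = 0) (hpos : ∀ x ∈ Ioo c d, 0 < u x) :
    α * a ≤ (Real.pi / (d - c)) ^ 2 ∧ (Real.pi / (d - c)) ^ 2 ≤ α * b := by
  set κ := Real.pi / (d - c) with hκ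
  have hdc : 0 < d - c := by linarith
  have hκ0 : 0 < κ := div_pos Real.pi_pos hdc
  have hκd : κ * (d - c) = Real.pi := div_mul_cancel₀ _ hdc.ne'
  -- Clamping `x` to `[c, d]` extends the sine by zero, because `sin 0 = sin π = 0`, and keeps it
  -- Lipschitz.
  set v : ℝ → ℝ := fun x => Real.sin (κ * (max c (min d x) - c)) with hv
  have hvl : LipschitzWith ‖κ‖₊ v := by
    refine LipschitzWith.of_dist_le_mul fun x y => ?_
    have h1 : LipschitzWith 1 fun x : ℝ => max c (min d x) :=
      (LipschitzWith.id.const_min d).const_max c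
    have h2 := h1.dist_le_mul x y
    have h3 := Real.lipschitzWith_sin.dist_le_mul (κ * (max c (min d x) - c))
      (κ * (max c (min d y) - c))
    simp only [NNReal.coe_one, one_mul] at h2 h3
    refine h3.trans ?_
    rw [Real.dist_eq, ← mul_sub, abs_mul, sub_sub_sub_cancel_right, coe_nnnorm, Real.norm_eq_abs]
    exact mul_le_mul_of_nonneg_left h2 (abs_nonneg _)
  have hv0 : ∀ x, x ≤ c ∨ d ≤ x → v x = 0 := by
    rintro x (hx | hx)
    · simp [hv, max_eq_left ((min_le_right d x).trans hx)]
    · simp [hv, min_eq_left hx, max_eq_right hcd.le, hκd]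
  have hv1 : ∀ x ∈ Icc c d, v x = Real.sin (κ * (x - c)) := fun x hx => by
    simp [hv, min_eq_right hx.2, max_eq_right hx.1]
  have hnn : ∀ x ∈ Icc c d, 0 ≤ u x := fun x hx => by
    rcases hx.1.eq_or_lt with rfl | h1
    · exact huc.ge
    rcases hx.2.eq_or_lt with rfl | h2
    · exact hud.ge
    exact (hpos x ⟨h1, h2⟩).le
  have hvpos : ∀ x ∈ Ioo c d, 0 < v x := fun x hx => by
    rw [hv1 x (Ioo_subset_Icc_self hx)]
    refine Real.sin_pos_of_pos_of_lt_pi (mul_pos hκ0 (by linarith [hx.1])) ?_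
    rw [← hκd]
    exact mul_lt_mul_of_pos_left (by linarith [hx.2]) hκ0
  have hvnn : ∀ x ∈ Icc c d, 0 ≤ v x := fun x hx => by
    rcases hx.1.eq_or_lt with rfl | h1
    · exact (hv0 _ (Or.inl le_rfl)).ge
    rcases hx.2.eq_or_lt with rfl | h2
    · exact (hv0 _ (Or.inr le_rfl)).ge
    exact (hvpos x ⟨h1, h2⟩).le
  have hw := hu.weak_of_nonneg hc hcd.le hd hnn hvl hv0
  have huC : ContinuousOn u (Icc c d) :=
    (hu.continuousOn (by linarith)).mono (Icc_subset_Icc hc hd)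
  have hC : ContinuousOn (fun x => u x * v x) (Icc c d) := huC.mul hvl.continuous.continuousOn
  have hB := hm.integral_mul_bounds hc hcd.le hd hC fun x hx => mul_nonneg (hnn x hx) (hvnn x hx)
  have hI : 0 < ∫ x in c..d, u x * v x :=
    intervalIntegral.intervalIntegral_pos_of_pos_on (hC.intervalIntegrable_of_Icc hcd.le)
      (fun x hx => mul_pos (hpos x hx) (hvpos x hx)) hcd
  have hparts : ∫ x in c..d, deriv u x * deriv v x = κ ^ 2 * ∫ x in c..d, u x * v x := by
    set ψ : ℝ → ℝ := fun x => κ * Real.cos (κ * (x - c)) with hψ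
    have hψd : ∀ x, HasDerivAt ψ (-(κ ^ 2 * Real.sin (κ * (x - c)))) x := fun x => by
      have := (((hasDerivAt_id' x).sub_const c).const_mul κ).cos.const_mul κ
      exact this.congr_deriv (by ring)
    have hψac : AbsolutelyContinuousOnInterval ψ c d := by
      refine ContDiffOn.absolutelyContinuousOnInterval (ContDiff.contDiffOn ?_)
      exact contDiff_const.mul (Real.contDiff_cos.comp (contDiff_const.mul
        (contDiff_id.sub contDiff_const)))
    -- `ψ` is `v'` inside `(c, d)` and `ψ' = -κ² v` there; the boundary terms vanish because `u`
    -- does at `c` and `d`.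
    have hP := hψac.integral_mul_deriv_eq_deriv_mul (hu.absCont_mono hc hcd.le hd)
    rw [huc, hud, mul_zero, mul_zero, sub_zero, zero_sub] at hP
    rw [← intervalIntegral.integral_const_mul, ← neg_neg (∫ x in c..d, κ ^ 2 * _),
      ← intervalIntegral.integral_neg]
    have e1 : ∫ x in c..d, deriv u x * deriv v x = ∫ x in c..d, ψ x * deriv u x := by
      refine integral_congr_of_eqOn_Ioo hcd.le fun x hx => ?_
      have h : v =ᶠ[nhds x] fun x => Real.sin (κ * (x - c)) := by
        filter_upwards [Ioo_mem_nhds hx.1 hx.2] with y hy using hv1 y (Ioo_subset_Icc_self hy)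
      rw [h.deriv_eq, (((hasDerivAt_id' x).sub_const c).const_mul κ).sin.deriv]
      simp only [hψ]
      ring
    rw [e1, hP]
    congr 1
    refine integral_congr_of_eqOn_Ioo hcd.le fun x hx => ?_
    rw [(hψd x).deriv, hv1 x (Ioo_subset_Icc_self hx)]
    ring
  rw [hparts] at hw
  constructor
  · refine le_of_mul_le_mul_right ?_ hI
    rw [hw, mul_assoc]
    exact mul_le_mul_of_nonneg_left hB.1 hα
  · refine le_of_mul_le_mul_right ?_ hI
    rw [hw, mul_assoc]
    exact mul_le_mul_of_nonneg_left hB.2 hα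

end IsFucikEigenfunction

/-! ### Structure of nodal domains -/

theorem isNodalDomain_neg {ℓ : ℝ} {u : ℝ → ℝ} {I : Set ℝ} :
    IsNodalDomain ℓ (fun x => -u x) I ↔ IsNodalDomain ℓ u I := by
  simp only [IsNodalDomain, ne_eq, neg_eq_zero]

theorem IsNodalDomain.exists_of_ne_zero {ℓ : ℝ} {u : ℝ → ℝ} {x : ℝ} (hx : x ∈ Ioo 0 ℓ)
    (h : u x ≠ 0) : ∃ I, IsNodalDomain ℓ u I ∧ x ∈ I :=
  ⟨_, ⟨x, ⟨hx, h⟩, rfl⟩, mem_connectedComponentIn ⟨hx, h⟩⟩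

theorem IsNodalDomain.exists_eq_Ioo {ℓ : ℝ} {u : ℝ → ℝ} (hu : ContinuousOn u (Icc 0 ℓ))
    (h0 : u 0 = 0) (h1 : u ℓ = 0) {I : Set ℝ} (hI : IsNodalDomain ℓ u I) :
    ∃ c d, 0 ≤ c ∧ c < d ∧ d ≤ ℓ ∧ I = Ioo c d ∧ u c = 0 ∧ u d = 0 ∧
      ((∀ x ∈ Ioo c d, 0 < u x) ∨ ∀ x ∈ Ioo c d, u x < 0) := by
  obtain ⟨x, hx, hIx⟩ := hI
  set S := {y ∈ Ioo 0 ℓ | u y ≠ 0} with hS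
  have hSo : IsOpen S :=
    (hu.mono Ioo_subset_Icc_self).isOpen_inter_preimage isOpen_Ioo isOpen_ne
  have hIo : IsOpen I := hIx ▸ hSo.connectedComponentIn
  have hIp : IsPreconnected I := hIx ▸ isPreconnected_connectedComponentIn
  have hIS : I ⊆ S := hIx ▸ connectedComponentIn_subset S x
  have hxI : x ∈ I := hIx ▸ mem_connectedComponentIn hx
  have hmax : ∀ T ⊆ S, IsPreconnected T → x ∈ T → T ⊆ I := fun T hTS hT hxT =>
    hIx ▸ hT.subset_connectedComponentIn hxT hTS
  have hbb : BddBelow I := ⟨0, fun y hy => (hIS hy).1.1.le⟩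
  have hba : BddAbove I := ⟨ℓ, fun y hy => (hIS hy).1.2.le⟩
  set c := sInf I with hc
  set d := sSup I with hd
  have hlo : ∀ y ∈ I, c < y := fun y hy => by
    refine (csInf_le hbb hy).lt_of_ne fun h => ?_
    obtain ⟨z, hz, hzI⟩ := (mem_nhdsLT_iff_exists_Ioo_subset.mp
      (mem_nhdsWithin_of_mem_nhds (hIo.mem_nhds hy)))
    obtain ⟨z', hz'⟩ := exists_between (mem_Iio.mp hz)
    have := csInf_le hbb (hzI hz')
    linarith [hz'.2]
  have hhi : ∀ y ∈ I, y < d := fun y hy => by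
    refine (le_csSup hba hy).lt_of_ne fun h => ?_
    obtain ⟨z, hz, hzI⟩ := (mem_nhdsGT_iff_exists_Ioo_subset.mp
      (mem_nhdsWithin_of_mem_nhds (hIo.mem_nhds hy)))
    obtain ⟨z', hz'⟩ := exists_between (mem_Ioi.mp hz)
    have := le_csSup hba (hzI hz')
    linarith [hz'.1]
  have hIeq : I = Ioo c d := Subset.antisymm (fun y hy => ⟨hlo y hy, hhi y hy⟩)
    (IsConnected.Ioo_csInf_csSup_subset ⟨⟨x, hxI⟩, hIp⟩ hbb hba)
  have hc0 : 0 ≤ c := le_csInf ⟨x, hxI⟩ fun y hy => (hIS hy).1.1.le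
  have hdl : d ≤ ℓ := csSup_le ⟨x, hxI⟩ fun y hy => (hIS hy).1.2.le
  have hcx := hlo x hxI
  have hxd := hhi x hxI
  refine ⟨c, d, hc0, hcx.trans hxd, hdl, hIeq, ?_, ?_, ?_⟩
  · rcases hc0.eq_or_lt with h | h
    · rw [← h, h0]
    by_contra hne
    -- If `u c ≠ 0`, adjoining `c` gives a larger connected subset of `S`, against maximality of the
    -- component.
    have hsub : Ico c d ⊆ S := fun y hy => by
      rcases hy.1.eq_or_lt with rfl | hy1
      · exact ⟨⟨h, by linarith⟩, hne⟩
      · exact hIS (hIeq ▸ ⟨hy1, hy.2⟩)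
    exact lt_irrefl c (hlo c (hmax _ hsub isPreconnected_Ico ⟨hcx.le, hxd⟩
      ⟨le_rfl, hcx.trans hxd⟩))
  · rcases hdl.eq_or_lt with h | h
    · rw [h, h1]
    by_contra hne
    have hsub : Ioc c d ⊆ S := fun y hy => by
      rcases hy.2.eq_or_lt with rfl | hy1
      · exact ⟨⟨by linarith, h⟩, hne⟩
      · exact hIS (hIeq ▸ ⟨hy.1, hy1⟩)
    exact lt_irrefl d (hhi d (hmax _ hsub isPreconnected_Ioc ⟨hcx, hxd.le⟩
      ⟨hcx.trans hxd, le_rfl⟩))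
  · rw [← hIeq]
    have huI : ContinuousOn u I := hu.mono fun y hy => Ioo_subset_Icc_self (hIS hy).1
    have himg : IsPreconnected (u '' I) := hIp.image u huI
    rcases lt_or_gt_of_ne hx.2 with h | h
    · refine Or.inr fun y hy => lt_of_not_ge fun hle => ?_
      obtain ⟨z, hz, hz0⟩ := himg.Icc_subset ⟨x, hxI, rfl⟩ ⟨y, hy, rfl⟩ ⟨h.le, hle⟩
      exact (hIS hz).2 hz0
    · refine Or.inl fun y hy => lt_of_not_ge fun hle => ?_
      obtain ⟨z, hz, hz0⟩ := himg.Icc_subset ⟨y, hy, rfl⟩ ⟨x, hxI, rfl⟩ ⟨hle, h.le⟩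
      exact (hIS hz).2 hz0

/-! ### Covering by nodal domains, and alternation of signs -/

namespace IsFucikEigenfunction

variable {ℓ a b α β : ℝ} {m n u : ℝ → ℝ}

theorem exists_eq_Ioo (hu : IsFucikEigenfunction ℓ m n α β u) (hℓ : 0 ≤ ℓ) {I : Set ℝ}
    (hI : IsNodalDomain ℓ u I) :
    ∃ c d, 0 ≤ c ∧ c < d ∧ d ≤ ℓ ∧ I = Ioo c d ∧ u c = 0 ∧ u d = 0 ∧
      ((∀ x ∈ Ioo c d, 0 < u x) ∨ ∀ x ∈ Ioo c d, u x < 0) :=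
  hI.exists_eq_Ioo (hu.continuousOn hℓ) hu.memH10.left hu.memH10.right

theorem weight_bounds_of_neg (hu : IsFucikEigenfunction ℓ m n α β u)
    (hn : IsWeight ℓ a b n) (hβ : 0 ≤ β) {c d : ℝ} (hc : 0 ≤ c) (hcd : c < d) (hd : d ≤ ℓ)
    (huc : u c = 0) (hud : u d = 0) (hneg : ∀ x ∈ Ioo c d, u x < 0) :
    β * a ≤ (Real.pi / (d - c)) ^ 2 ∧ (Real.pi / (d - c)) ^ 2 ≤ β * b :=
  hu.neg.weight_bounds_of_pos hn hβ hc hcd hd (by simp [huc]) (by simp [hud])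
    fun x hx => neg_pos.mpr (hneg x hx)

theorem eq_zero_of_nonpos_of_eq_zero (hu : IsFucikEigenfunction ℓ m n α β u) (ha : 0 ≤ a)
    (hn : IsWeight ℓ a b n) (hβ : 0 ≤ β) {p q r : ℝ} (hp : 0 ≤ p) (hpq : p < q) (hqr : q < r)
    (hr : r ≤ ℓ) (hneg : ∀ x ∈ Icc p r, u x ≤ 0) (hq : u q = 0) : u p = 0 ∧ u r = 0 := by
  simpa using hu.neg.eq_zero_of_nonneg_of_eq_zero ha hn hβ hp hpq hqr hr
    (fun x hx => neg_nonneg.mpr (hneg x hx)) (by simp [hq])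

/-- If there are finitely many nodal domains, then their closures cover `(0, ℓ)`. -/
theorem exists_mem_Icc_of_finite (hu : IsFucikEigenfunction ℓ m n α β u) (ha : 0 ≤ a)
    (hm : IsWeight ℓ a b m) (hn : IsWeight ℓ a b n) (hα : 0 ≤ α) (hβ : 0 ≤ β)
    (hfin : {I : Set ℝ | IsNodalDomain ℓ u I}.Finite) {z : ℝ} (hz : z ∈ Ioo 0 ℓ) :
    ∃ I, IsNodalDomain ℓ u I ∧ z ∈ Icc (sInf I) (sSup I) := by
  have hℓ : 0 ≤ ℓ := hz.1.le.trans hz.2.le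
  by_contra! hcov
  have key : ∀ I, IsNodalDomain ℓ u I → ∃ c d, sInf I = c ∧ sSup I = d ∧ 0 ≤ c ∧ c < d ∧ d ≤ ℓ ∧
      I = Ioo c d ∧ u c = 0 ∧ u d = 0 ∧ (z < c ∨ d < z) ∧
      ((∀ x ∈ Ioo c d, 0 < u x) ∨ ∀ x ∈ Ioo c d, u x < 0) := by
    intro I hI
    obtain ⟨c, d, hc, hcd, hd, rfl, huc, hud, hs⟩ := hu.exists_eq_Ioo hℓ hI
    have h := hcov _ hI
    rw [csInf_Ioo hcd, csSup_Ioo hcd] at h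
    refine ⟨c, d, csInf_Ioo hcd, csSup_Ioo hcd, hc, hcd, hd, rfl, huc, hud, ?_, hs⟩
    by_contra! h'
    exact h h'
  obtain ⟨x₀, hx₀, hux₀⟩ := hu.nontrivial
  have hx₀' : x₀ ∈ Ioo 0 ℓ := by
    refine ⟨hx₀.1.lt_of_ne ?_, hx₀.2.lt_of_ne ?_⟩
    · rintro rfl
      exact hux₀ hu.memH10.left
    · rintro rfl
      exact hux₀ hu.memH10.right
  obtain ⟨I₀, hI₀, -⟩ := IsNodalDomain.exists_of_ne_zero hx₀' hux₀
  obtain ⟨c₀, d₀, hc₀, hd₀, -, -, -, -, -, -, hs₀, -⟩ := key I₀ hI₀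
  rcases hs₀ with hs₀ | hs₀
  · obtain ⟨I, ⟨hI, hzI⟩, hmin⟩ := (hfin.inter_of_left {I : Set ℝ | z < sInf I}).exists_minimalFor
      sInf _ ⟨I₀, hI₀, by rwa [mem_ofPred_eq, hc₀]⟩
    obtain ⟨c, d, hc, hd, hc0, hcd, hdl, rfl, huc, hud, -, hs⟩ := key I hI
    rw [mem_ofPred_eq, hc] at hzI
    have hzero : ∀ y ∈ Icc z c, u y = 0 := by
      intro y hy
      by_contra hne
      obtain ⟨J, hJ, hyJ⟩ := IsNodalDomain.exists_of_ne_zero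
        (ℓ := ℓ) ⟨hz.1.trans_le hy.1, by linarith [hy.2]⟩ hne
      obtain ⟨c', d', hc', -, -, -, -, rfl, -, -, hz', -⟩ := key J hJ
      have hzc : z < c' := hz'.resolve_right (by linarith [hy.1, hyJ.2])
      have := hmin (j := Ioo c' d') ⟨hJ, by rwa [mem_ofPred_eq, hc']⟩
        (by rw [hc, hc']; linarith [hyJ.1, hy.2])
      rw [hc, hc'] at this
      linarith [hyJ.1, hy.2]
    set y := (c + d) / 2 with hy
    have hcy : c < y := by linarith
    have hyd : y < d := by linarith
    rcases hs with hs | hs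
    · refine (hs y ⟨hcy, hyd⟩).ne' (hu.eq_zero_of_nonneg_of_eq_zero ha hm hα hz.1.le hzI hcy
        (by linarith) (fun x hx => ?_) huc).2
      rcases le_or_gt x c with h | h
      · exact (hzero x ⟨hx.1, h⟩).ge
      · exact (hs x ⟨h, by linarith [hx.2]⟩).le
    · refine (hs y ⟨hcy, hyd⟩).ne (hu.eq_zero_of_nonpos_of_eq_zero ha hn hβ hz.1.le hzI hcy
        (by linarith) (fun x hx => ?_) huc).2
      rcases le_or_gt x c with h | h
      · exact (hzero x ⟨hx.1, h⟩).le
      · exact (hs x ⟨h, by linarith [hx.2]⟩).le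
  · obtain ⟨I, ⟨hI, hzI⟩, hmax⟩ := (hfin.inter_of_left {I : Set ℝ | sSup I < z}).exists_maximalFor
      sSup _ ⟨I₀, hI₀, by rwa [mem_ofPred_eq, hd₀]⟩
    obtain ⟨c, d, hc, hd, hc0, hcd, hdl, rfl, huc, hud, -, hs⟩ := key I hI
    rw [mem_ofPred_eq, hd] at hzI
    have hzero : ∀ y ∈ Icc d z, u y = 0 := by
      intro y hy
      by_contra hne
      obtain ⟨J, hJ, hyJ⟩ := IsNodalDomain.exists_of_ne_zero
        (ℓ := ℓ) ⟨by linarith [hy.1], hy.2.trans_lt hz.2⟩ hne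
      obtain ⟨c', d', -, hd', -, -, -, rfl, -, -, hz', -⟩ := key J hJ
      have hzd : d' < z := hz'.resolve_left (by linarith [hy.2, hyJ.1])
      have := hmax (j := Ioo c' d') ⟨hJ, by rwa [mem_ofPred_eq, hd']⟩
        (by rw [hd, hd']; linarith [hyJ.2, hy.1])
      rw [hd, hd'] at this
      linarith [hyJ.2, hy.1]
    set y := (c + d) / 2 with hy
    have hcy : c < y := by linarith
    have hyd : y < d := by linarith
    rcases hs with hs | hs
    · refine (hs y ⟨hcy, hyd⟩).ne' (hu.eq_zero_of_nonneg_of_eq_zero ha hm hα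
        (hc0.trans hcy.le) hyd hzI hz.2.le (fun x hx => ?_) hud).1
      rcases le_or_gt d x with h | h
      · exact (hzero x ⟨h, hx.2⟩).ge
      · exact (hs x ⟨by linarith [hx.1], h⟩).le
    · refine (hs y ⟨hcy, hyd⟩).ne (hu.eq_zero_of_nonpos_of_eq_zero ha hn hβ
        (hc0.trans hcy.le) hyd hzI hz.2.le (fun x hx => ?_) hud).1
      rcases le_or_gt d x with h | h
      · exact (hzero x ⟨h, hx.2⟩).le
      · exact (hs x ⟨by linarith [hx.1], h⟩).le

/-- Bounds on `L` from bounds on the first Dirichlet eigenvalue `(π / L) ^ 2`. -/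
theorem length_bounds {γ L : ℝ} (ha : 0 < a) (hb : 0 < b) (hγ : 0 < γ) (hL : 0 < L)
    (h : γ * a ≤ (Real.pi / L) ^ 2 ∧ (Real.pi / L) ^ 2 ≤ γ * b) :
    Real.pi / √(γ * b) ≤ L ∧ L ≤ Real.pi / √(γ * a) := by
  have hq : 0 < Real.pi / L := div_pos Real.pi_pos hL
  constructor
  · rw [div_le_comm₀ (Real.sqrt_pos.mpr (mul_pos hγ hb)) hL]
    exact Real.le_sqrt_of_sq_le h.2
  · rw [le_div_comm₀ hL (Real.sqrt_pos.mpr (mul_pos hγ ha))]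
    exact Real.sqrt_le_iff.mpr ⟨hq.le, h.1⟩

/-- An eigenfunction with `k` nodal domains forces `ℓ ≤ k π / √(a min(α, β))`. -/
theorem length_le_of_encard (hu : IsFucikEigenfunction ℓ m n α β u) (hℓ : 0 ≤ ℓ) (ha : 0 < a)
    (hb : 0 < b) (hm : IsWeight ℓ a b m) (hn : IsWeight ℓ a b n) (hα : 0 < α) (hβ : 0 < β) {k : ℕ}
    (hk : {I : Set ℝ | IsNodalDomain ℓ u I}.encard = k) :
    ℓ ≤ k * (Real.pi / √(min α β * a)) := by
  have hfin : {I : Set ℝ | IsNodalDomain ℓ u I}.Finite := finite_of_encard_eq_coe hk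
  set D := Real.pi / √(min α β * a) with hD
  have hP : 0 < min α β := lt_min hα hβ
  have hD0 : 0 ≤ D := by positivity
  have hlen : ∀ γ, min α β ≤ γ → Real.pi / √(γ * a) ≤ D := fun γ hγ =>
    div_le_div_of_nonneg_left Real.pi_pos.le (Real.sqrt_pos.mpr (mul_pos hP ha))
      (Real.sqrt_le_sqrt (mul_le_mul_of_nonneg_right hγ ha.le))
  have hI : ∀ I ∈ hfin.toFinset, volume (Icc (sInf I) (sSup I)) ≤ ENNReal.ofReal D := by
    intro I hI
    rw [Finite.mem_toFinset] at hI
    obtain ⟨c, d, hc, hcd, hd, rfl, huc, hud, hs⟩ := hu.exists_eq_Ioo hℓ hI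
    rw [csInf_Ioo hcd, csSup_Ioo hcd, Real.volume_Icc]
    refine ENNReal.ofReal_le_ofReal ?_
    rcases hs with hs | hs
    · exact (length_bounds ha hb hα (sub_pos.mpr hcd)
        (hu.weight_bounds_of_pos hm hα.le hc hcd hd huc hud hs)).2.trans (hlen α (min_le_left _ _))
    · exact (length_bounds ha hb hβ (sub_pos.mpr hcd)
        (hu.weight_bounds_of_neg hn hβ.le hc hcd hd huc hud hs)).2.trans (hlen β (min_le_right _ _))
  have hcover : Ioo 0 ℓ ⊆ ⋃ I ∈ hfin.toFinset, Icc (sInf I) (sSup I) := fun z hz => by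
    obtain ⟨I, hI, hzI⟩ := hu.exists_mem_Icc_of_finite ha.le hm hn hα.le hβ.le hfin hz
    exact mem_biUnion (by simpa using hI) hzI
  have hcard : hfin.toFinset.card = k := by
    rw [hfin.encard_eq_coe_toFinset_card] at hk
    exact_mod_cast hk
  have h : ENNReal.ofReal ℓ ≤ ENNReal.ofReal (k * D) := calc
    ENNReal.ofReal ℓ = volume (Ioo 0 ℓ) := by rw [Real.volume_Ioo, sub_zero]
    _ ≤ ∑ I ∈ hfin.toFinset, volume (Icc (sInf I) (sSup I)) :=
      (measure_mono hcover).trans (measure_biUnion_finset_le _ _)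
    _ ≤ hfin.toFinset.card • ENNReal.ofReal D := Finset.sum_le_card_nsmul _ _ _ hI
    _ = ENNReal.ofReal (k * D) := by
      rw [hcard, nsmul_eq_mul, ENNReal.ofReal_mul (Nat.cast_nonneg k), ENNReal.ofReal_natCast]
  exact (ENNReal.ofReal_le_ofReal_iff (by positivity)).mp h

/-- An eigenfunction is not positive on two consecutive nodal domains. -/
theorem not_pos_of_consecutive (hu : IsFucikEigenfunction ℓ m n α β u)
    (ha : 0 ≤ a) (hm : IsWeight ℓ a b m) (hα : 0 ≤ α) {c d e f : ℝ}
    (h : AreConsecutiveNodalDomains ℓ u (Ioo c d) (Ioo e f)) (hc : 0 ≤ c) (hcd : c < d)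
    (hef : e < f) (hf : f ≤ ℓ) (hud : u d = 0) (hue : u e = 0)
    (h1 : ∀ x ∈ Ioo c d, 0 < u x) (h2 : ∀ x ∈ Ioo e f, 0 < u x) : False := by
  have hde : d ≤ e := by
    by_contra! hlt
    obtain ⟨x, hx1, hx2⟩ := exists_between (max_lt hcd hlt)
    obtain ⟨hcx, hex⟩ := max_lt_iff.mp hx1
    obtain ⟨y, hy1, hy2⟩ := exists_between (lt_min hex hef)
    obtain ⟨hyx, hyf⟩ := lt_min_iff.mp hy2
    exact lt_asymm hyx (h.lt x ⟨hcx, hx2⟩ y ⟨hy1, hyf⟩)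
  -- A nonzero value in the gap would produce a nodal domain between the two. With `u = 0` there, `u
  -- ≥ 0` across `d`, and the zero at `d` contradicts the maximum principle.
  have hzero : ∀ y ∈ Icc d e, u y = 0 := by
    intro y hy
    by_contra hne
    obtain ⟨K, hK, hyK⟩ := IsNodalDomain.exists_of_ne_zero
      (ℓ := ℓ) ⟨by linarith [hy.1], by linarith [hy.2]⟩ hne
    obtain ⟨c', d', -, -, -, rfl, -, -, hs⟩ := hu.exists_eq_Ioo (by linarith) hK
    have hs' : ∀ x ∈ Ioo c' d', u x ≠ 0 := fun x hx =>
      hs.elim (fun h => (h x hx).ne') fun h => (h x hx).ne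
    have hdc : d ≤ c' := by
      by_contra! hlt
      exact hs' d ⟨hlt, hy.1.trans_lt hyK.2⟩ hud
    have hde' : d' ≤ e := by
      by_contra! hlt
      exact hs' e ⟨hyK.1.trans_le hy.2, hlt⟩ hue
    exact h.none_between _ hK ⟨fun x hx z hz => by linarith [hx.2, hz.1],
      fun z hz y hy => by linarith [hz.2, hy.1]⟩
  have hp := h1 ((c + d) / 2) ⟨by linarith, by linarith⟩
  refine hp.ne' (hu.eq_zero_of_nonneg_of_eq_zero ha hm hα (p := (c + d) / 2) (q := d)
    (r := (e + f) / 2) (by linarith) (by linarith) (by linarith) (by linarith)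
    (fun x hx => ?_) hud).1
  rcases lt_or_ge x d with hxd | hxd
  · exact (h1 x ⟨by linarith [hx.1], hxd⟩).le
  rcases le_or_gt x e with hxe | hxe
  · exact (hzero x ⟨hxd, hxe⟩).ge
  · exact (h2 x ⟨hxe, by linarith [hx.2]⟩).le

theorem not_neg_of_consecutive (hu : IsFucikEigenfunction ℓ m n α β u)
    (ha : 0 ≤ a) (hn : IsWeight ℓ a b n) (hβ : 0 ≤ β) {c d e f : ℝ}
    (h : AreConsecutiveNodalDomains ℓ u (Ioo c d) (Ioo e f)) (hc : 0 ≤ c) (hcd : c < d)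
    (hef : e < f) (hf : f ≤ ℓ) (hud : u d = 0) (hue : u e = 0)
    (h1 : ∀ x ∈ Ioo c d, u x < 0) (h2 : ∀ x ∈ Ioo e f, u x < 0) : False :=
  hu.neg.not_pos_of_consecutive ha hn hβ
    { fst := isNodalDomain_neg.mpr h.fst
      snd := isNodalDomain_neg.mpr h.snd
      lt := h.lt
      none_between := fun K hK => h.none_between K (isNodalDomain_neg.mp hK) }
    hc hcd hef hf (by simp [hud]) (by simp [hue])
    (fun x hx => neg_pos.mpr (h1 x hx)) fun x hx => neg_pos.mpr (h2 x hx)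

end IsFucikEigenfunction

/-! ### Constants and conclusion -/

theorem exists_eigenfunction_of_mem_fucikCurve {ℓ α β : ℝ} {m n : ℝ → ℝ} {k : ℕ}
    (h : (α, β) ∈ fucikCurve ℓ m n k) : ∃ w, IsFucikEigenfunction ℓ m n α β w ∧
      {I : Set ℝ | IsNodalDomain ℓ w I}.encard = k := by
  rcases h with ⟨w, hw, hk, -⟩ | ⟨w, hw, hk, -⟩ <;> exact ⟨w, hw, hk⟩

theorem div_mul_sqrt_le_of_le {ℓ a b P : ℝ} {k : ℕ} (hk : 1 ≤ k) (ha : 0 < a) (hb : 0 < b)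
    (hP : 0 < P) (h : ℓ ≤ k * (Real.pi / √(P * a))) : ℓ / k * √(a / b) ≤ Real.pi / √(P * b) := by
  have hk0 : (0 : ℝ) < k := by exact_mod_cast hk
  have h1 : ℓ / k ≤ Real.pi / √(P * a) := by
    rw [div_le_iff₀ hk0]; linarith
  refine (mul_le_mul_of_nonneg_right h1 (Real.sqrt_nonneg _)).trans (le_of_eq ?_)
  rw [Real.sqrt_div ha.le, Real.sqrt_mul hP.le, Real.sqrt_mul hP.le]
  have := (Real.sqrt_pos.mpr ha).ne'
  have := (Real.sqrt_pos.mpr hb).ne'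
  have := (Real.sqrt_pos.mpr hP).ne'
  field_simp

theorem sqrt_mul_pi_div_le {b t P Q : ℝ} (hb : 0 < b) (ht : 0 ≤ t) (hP : 0 < P) (hQ : 0 < Q)
    (h : t * Q ≤ P) : √t * (Real.pi / √(P * b)) ≤ Real.pi / √(Q * b) := by
  rw [mul_div_left_comm, div_eq_mul_inv Real.pi]
  refine mul_le_mul_of_nonneg_left ?_ Real.pi_pos.le
  rw [div_le_iff₀ (Real.sqrt_pos.mpr (mul_pos hP hb)), inv_mul_eq_div,
    le_div_iff₀ (Real.sqrt_pos.mpr (mul_pos hQ hb)), ← Real.sqrt_mul ht]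
  exact Real.sqrt_le_sqrt (by nlinarith)

theorem theorem2p3 (ℓ a b t : ℝ) (hℓ : 0 < ℓ) (ha : 0 < a) (ht0 : 0 < t) (ht1 : t < 1)
    (m n : ℝ → ℝ) (hm : IsWeight ℓ a b m) (hn : IsWeight ℓ a b n)
    (k : ℕ) (hk : 1 ≤ k) (α β : ℝ) (hαβ : (α, β) ∈ fucikCurve ℓ m n k ∩ fucikCone t)
    (u : ℝ → ℝ) (hu : IsFucikEigenfunction ℓ m n α β u) :
    (∀ I : Set ℝ, IsNodalDomain ℓ u I →
      ℓ / k * √(t * (a / b)) ≤ volume.real I) ∧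
    (∀ I I' : Set ℝ, AreConsecutiveNodalDomains ℓ u I I' →
      ℓ / k * √(a / b) * (1 + √t) ≤ volume.real (I ∪ I')) := by
  obtain ⟨hcurve, hα, hβ, htα, htβ⟩ := hαβ
  simp only at hα hβ htα htβ
  -- `(0, ℓ)` has positive measure, so `a ≤ m x ≤ b` holds at some point.
  have hb : 0 < b := by
    have : (volume.restrict (Ioo 0 ℓ)) ≠ 0 := by
      simp [Measure.restrict_eq_zero, hℓ]
    have : (ae (volume.restrict (Ioo 0 ℓ))).NeBot := ae_neBot.mpr this
    obtain ⟨x, hx⟩ := hm.bounds.exists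
    linarith
  have htβ' : t * β ≤ α := by
    have := mul_le_mul_of_nonneg_left htβ ht0.le
    rwa [mul_inv_cancel_left₀ ht0.ne'] at this
  -- The count `k` is known for `w` only; it bears on `u` through the shared pair `(α, β)`.
  obtain ⟨w, hw, hwk⟩ := exists_eigenfunction_of_mem_fucikCurve hcurve
  set P := min α β with hP
  have hP0 : 0 < P := lt_min hα hβ
  set D := Real.pi / √(P * b) with hD
  have hmain : ℓ / k * √(a / b) ≤ D := div_mul_sqrt_le_of_le hk ha hb hP0
    (hw.length_le_of_encard hℓ.le ha hb hm hn hα hβ hwk)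
  have hbα : √t * D ≤ Real.pi / √(α * b) := sqrt_mul_pi_div_le hb ht0.le hP0 hα
    (le_min (by nlinarith) htα)
  have hbβ : √t * D ≤ Real.pi / √(β * b) := sqrt_mul_pi_div_le hb ht0.le hP0 hβ
    (le_min htβ' (by nlinarith))
  -- The term whose parameter is the minimum equals `D`; the other is at least `√t * D`.
  have hsum : D * (1 + √t) ≤ Real.pi / √(α * b) + Real.pi / √(β * b) := by
    rcases min_choice α β with h | h
    · have : D = Real.pi / √(α * b) := by rw [hD, hP, h]
      linarith
    · have : D = Real.pi / √(β * b) := by rw [hD, hP, h]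
      linarith
  have hpos : ∀ c d : ℝ, 0 ≤ c → c < d → d ≤ ℓ → u c = 0 → u d = 0 → (∀ x ∈ Ioo c d, 0 < u x) →
      Real.pi / √(α * b) ≤ d - c := fun c d hc hcd hd huc hud hs =>
    (IsFucikEigenfunction.length_bounds ha hb hα (sub_pos.mpr hcd)
      (hu.weight_bounds_of_pos hm hα.le hc hcd hd huc hud hs)).1
  have hneg : ∀ c d : ℝ, 0 ≤ c → c < d → d ≤ ℓ → u c = 0 → u d = 0 → (∀ x ∈ Ioo c d, u x < 0) →
      Real.pi / √(β * b) ≤ d - c := fun c d hc hcd hd huc hud hs =>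
    (IsFucikEigenfunction.length_bounds ha hb hβ (sub_pos.mpr hcd)
      (hu.weight_bounds_of_neg hn hβ.le hc hcd hd huc hud hs)).1
  constructor
  · intro I hI
    obtain ⟨c, d, hc, hcd, hd, rfl, huc, hud, hs⟩ := hu.exists_eq_Ioo hℓ.le hI
    rw [Real.volume_real_Ioo_of_le hcd.le, Real.sqrt_mul ht0.le, mul_left_comm]
    refine (mul_le_mul_of_nonneg_left hmain (Real.sqrt_nonneg t)).trans ?_
    rcases hs with hs | hs
    · exact hbα.trans (hpos c d hc hcd hd huc hud hs)
    · exact hbβ.trans (hneg c d hc hcd hd huc hud hs)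
  · intro I I' h
    obtain ⟨c, d, hc, hcd, hd, rfl, huc, hud, hs⟩ := hu.exists_eq_Ioo hℓ.le h.fst
    obtain ⟨e, f, he, hef, hf, rfl, hue, huf, hs'⟩ := hu.exists_eq_Ioo hℓ.le h.snd
    have hdisj : Disjoint (Ioo c d) (Ioo e f) :=
      disjoint_left.mpr fun x hx hx' => lt_irrefl x (h.lt x hx x hx')
    rw [measureReal_union hdisj measurableSet_Ioo measure_Ioo_lt_top.ne measure_Ioo_lt_top.ne,
      Real.volume_real_Ioo_of_le hcd.le,
      Real.volume_real_Ioo_of_le hef.le]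
    refine (mul_le_mul_of_nonneg_right hmain (by positivity)).trans (hsum.trans ?_)
    rcases hs with hs | hs <;> rcases hs' with hs' | hs'
    · exact (hu.not_pos_of_consecutive ha.le hm hα.le h hc hcd hef hf hud hue hs hs').elim
    · exact add_le_add (hpos c d hc hcd hd huc hud hs) (hneg e f he hef hf hue huf hs')
    · rw [add_comm]
      exact add_le_add (hneg c d hc hcd hd huc hud hs) (hpos e f he hef hf hue huf hs')
    · exact (hu.not_neg_of_consecutive ha.le hn hβ.le h hc hcd hef hf hud hue hs hs').elim
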